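/- **Setting.** Let $X$ be a set of generators and $R\subset F(X)$ a finite symmetrized set (all $r\in R$ are cyclically reduced, and $R$ is closed under inverses and cyclic permutations), with total length $L(R)=\sum_{r\in R}|r|$; assume that $L(R)\ge 1$, i.e. $R$ contains a non-trivial word. A weighted $X$-digraph $\Gamma=(V,E,\mu,\gamma)$ is a finite directed graph (loops and parallel edges allowed) with labels $\mu:E\to X^{\pm}$ and weights $\gamma:E\to\mathbb Z$, together with a modulus $N\in\mathbb N\cup\{\infty\}$; put $|\Gamma|=|V|+|E|$. The inverse of an edge $a\stackrel{x,k}{\to}b$ is $b\stackrel{x^{-1},-k}{\to}a$. The $R$-completion of $\Gamma$ is obtained by attaching, at every $v\in V$ and for every $r\in R$, a new circuit labelled with $r$ all of whose edges have weight $0$, together with the inverse edges. A graph is *folded* if at most one edge with a given label leaves a given vertex. The shift by $\delta$ at $v$ adds $\delta$ to the weights of the edges leaving $v$ and subtracts $\delta$ from those of the edges entering $v$ (loops at $v$ are unchanged). A *fold* takes two distinct edges $e_1=(u\stackrel{x,a}{\to}v_1)$, $e_2=(u\stackrel{x,b}{\to}v_2)$. If $v_1=v_2$ it removes one of them and replaces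 $N$ by $\gcd(N,b-a)$ (which is $N$ if $a\equiv b \bmod N$; $N=\infty$ is treated as $0$). If $v_1\ne v_2$ it shifts by $a-b$ at $v_1$ (or by $b-a$ at $v_2$), identifies $v_1$ with $v_2$ and removes $e_2$. A folded graph reached from $\Gamma$ by a sequence of folds is denoted by $\mathrm{Fold}(\Gamma)$; it is taken up to the choices made. *The folding procedure.* Classes of identified vertices are kept as rooted trees with parent pointers $p(v)$ and shift values $\delta(v)$; the total shift is $\Delta(v)=0$ at roots and $\Delta(v)=\delta(v)+\Delta(p(v))$ otherwise. Looking up a vertex computes its root and total shift with path compression. Edges are processed one by one. The current weight of an edge $e$ is $\gamma(e)+\Delta(o(e))-\Delta(t(e))$, where $o(e)$, $t(e)$ are its origin and terminus. If no processed edge with the same label leaves the class of $o(e)$, then $e$ is kept; otherwise it is folded with that edge. To identify two distinct classes, the root of smaller rank becomes a child of the other one (ties are broken by a fixed rule) with the required shift value, the lists of outgoing edges are joined, and edges whose label then occurs twice are processed again. When no edge is left to process, the current forms of the remaining edges are computed and written out. Every addition or subtraction of weights and shifts, every increment of a rank and every $\gcd$ update of $N$ is counted as one addition. Let $\log^\ast$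 denote the inverse Ackermann function $\log^\ast(n)=\min\{k: n\le A(k,k)\}$, where $A$ is the Ackermann function. **Statement.** There is an absolute constant $C$ such that for all $X$, all $R$ as above and every finite weighted $X$-digraph $\Gamma$ (with any modulus), the folding procedure applied to the $R$-completion of $\Gamma$, with its vertices and edges listed in any order, halts with output $\mathrm{Fold}$ of the $R$-completion of $\Gamma$, and the total number of additions performed is at most $$C\cdot|\Gamma|\,L(R)\,\log^\ast\bigl(|\Gamma|\,L(R)\bigr).$$ ($R$-completion itself performs no addition, since all new weights are $0$.) -/

import Mathlib

/-! ### Inverse Ackermann function -/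

/-- The inverse Ackermann function: the least `k` with `n ≤ A(k, k)`. -/
noncomputable def invAck (n : ℕ) : ℕ := sInf {k : ℕ | n ≤ ack k k}

/-! ### Symmetrized presentations -/

/-- `R` contains only cyclically reduced words and is closed under taking inverses and cyclic
permutations. -/
def IsSymmetrized {X : Type*} [DecidableEq X] (R : Finset (FreeGroup X)) : Prop :=
  (∀ r ∈ R, FreeGroup.IsCyclicallyReduced r.toWord) ∧
  (∀ r ∈ R, r⁻¹ ∈ R) ∧
  (∀ r ∈ R, ∀ k : ℕ, FreeGroup.mk (r.toWord.rotate k) ∈ R)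

/-- The total length `L(R)`. -/
def totalLength {X : Type*} [DecidableEq X] (R : Finset (FreeGroup X)) : ℕ :=
  ∑ r ∈ R, r.norm

/-! ### Weighted `X`-digraphs -/

/-- An edge with origin `src`, label `lab` in `X^±` (the letter `(x, true)` is `x` and `(x, false)`
is `x⁻¹`), weight `wt` and terminus `tgt`. -/
@[ext]
structure WEdge (V X : Type*) where
  src : V
  lab : X × Bool
  wt : ℤ
  tgt : V
deriving DecidableEq

namespace WEdge

variable {V W X : Type*}

/-- The inverse edge. -/
def inv (e : WEdge V X) : WEdge V X := ⟨e.tgt, (e.lab.1, !e.lab.2), -e.wt, e.src⟩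

/-- Rename the endpoints of an edge. -/
def map (f : V → W) (e : WEdge V X) : WEdge W X := ⟨f e.src, e.lab, e.wt, f e.tgt⟩

/-- The effect on an edge of the shift by `δ` at `v`: the weights of edges leaving `v` grow by `δ`,
those of edges entering `v` decrease by `δ`; loops at `v` keep their weight. -/
def shift [DecidableEq V] (v : V) (δ : ℤ) (e : WEdge V X) : WEdge V X :=
  { e with wt := e.wt + (if e.src = v then δ else 0) - (if e.tgt = v then δ else 0) }

end WEdge

/-- A finite weighted `X`-digraph (parallel edges and loops allowed), together with the modulus `N`
of its weights; `modulus = 0` stands for `N = ∞`. -/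
structure WDigraph (V X : Type*) where
  verts : Finset V
  edges : Multiset (WEdge V X)
  modulus : ℕ

/-- The function that sends `v₁` to `v₂` and fixes all other vertices. -/
def glue {V : Type*} [DecidableEq V] (v₁ v₂ : V) (v : V) : V := if v = v₁ then v₂ else v

/-- Vertices of an `R`-completed graph: the old ones, and for each old vertex `v` and relator `r`
the interior vertices `mid v r i` (`0 < i < |r|`) of the circuit attached at `v`. -/
inductive CVert (V X : Type*) where
  | old (v : V) : CVert V X
  | mid (v : V) (r : FreeGroup X) (i : ℕ) : CVert V X
deriving DecidableEq

/-- The `i`-th vertex of the circuit labelled with `r` at `v`, where `0 ≤ i ≤ |r|`. -/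
def circuitVert {V X : Type*} [DecidableEq X] (v : V) (r : FreeGroup X) (i : ℕ) : CVert V X :=
  if i = 0 ∨ i = r.norm then CVert.old v else CVert.mid v r i

/-- The edges, each of weight `0`, of the circuit labelled with `r` at `v`. -/
def circuitEdge {V X : Type*} [DecidableEq X] (v : V) (r : FreeGroup X)
    (i : Fin r.toWord.length) : WEdge (CVert V X) X :=
  ⟨circuitVert v r i, r.toWord[i], 0, circuitVert v r (i + 1)⟩

namespace WDigraph

variable {V X : Type*}

/-- All edges have their endpoints among the vertices. -/
def Incident (Γ : WDigraph V X) : Prop := ∀ e ∈ Γ.edges, e.src ∈ Γ.verts ∧ e.tgt ∈ Γ.verts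

/-- The size `|Γ| = |V| + |E|`. -/
def size (Γ : WDigraph V X) : ℕ := Γ.verts.card + Γ.edges.card

/-- At most one edge with a given origin and label. -/
def Folded [DecidableEq V] [DecidableEq X] (Γ : WDigraph V X) : Prop :=
  ∀ (a : V) (x : X × Bool),
    Multiset.card (Γ.edges.filter fun e => e.src = a ∧ e.lab = x) ≤ 1

/-- Weight-shift by `δ` at `v`. -/
def shift [DecidableEq V] (Γ : WDigraph V X) (v : V) (δ : ℤ) : WDigraph V X :=
  { Γ with edges := Γ.edges.map (WEdge.shift v δ) }

/-- Identification of `v₁` and `v₂`; the new vertex gets the name `v₂`. -/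
def identify [DecidableEq V] (Γ : WDigraph V X) (v₁ v₂ : V) : WDigraph V X :=
  { Γ with
    verts := Γ.verts.image (glue v₁ v₂)
    edges := Γ.edges.map (WEdge.map (glue v₁ v₂)) }

/-- A single fold of two distinct edges `e₁ = (u, x, a, v₁)` and `e₂ = (u, x, b, v₂)`.

* If the termini agree, one edge is removed and the modulus `N` is replaced by `gcd(N, b - a)`
  (which is `N` itself when `a ≡ b mod N`, and is `|b - a|` when `N = ∞`).
* Otherwise a shift by `a - b` at `v₁` makes the weights agree, `v₁` and `v₂` are identified and the
  image of `e₂` is removed. Exchanging the roles of `e₁` and `e₂` gives the variant that shifts `v₂`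
  by `b - a`. -/
inductive FoldStep [DecidableEq V] [DecidableEq X] : WDigraph V X → WDigraph V X → Prop
  | remove (Γ : WDigraph V X) (u w : V) (x : X × Bool) (a b : ℤ) (M : Multiset (WEdge V X))
      (h : Γ.edges = ⟨u, x, a, w⟩ ::ₘ ⟨u, x, b, w⟩ ::ₘ M) :
      FoldStep Γ
        { Γ with
          edges := ⟨u, x, a, w⟩ ::ₘ M
          modulus := Nat.gcd Γ.modulus (b - a).natAbs }
  | merge (Γ : WDigraph V X) (u v₁ v₂ : V) (x : X × Bool) (a b : ℤ)
      (h₁ : ⟨u, x, a, v₁⟩ ∈ Γ.edges) (h₂ : ⟨u, x, b, v₂⟩ ∈ Γ.edges) (hne : v₁ ≠ v₂) :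
      FoldStep Γ
        { (Γ.shift v₁ (a - b)).identify v₁ v₂ with
          edges := ((Γ.shift v₁ (a - b)).identify v₁ v₂).edges.erase
            (WEdge.map (glue v₁ v₂) (WEdge.shift v₁ (a - b) ⟨u, x, b, v₂⟩)) }

/-- `Δ` is a result `Fold(Γ)` of folding `Γ`: it is folded, and a sequence of folds leads
from `Γ` to `Δ`. -/
def IsFold [DecidableEq V] [DecidableEq X] (Γ Δ : WDigraph V X) : Prop :=
  Relation.ReflTransGen FoldStep Γ Δ ∧ Δ.Folded

/-- `R`-completion: at every vertex `v` and for every `r ∈ R` a new circuit of weight `0` labelled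
with `r` (and its inverse edges) is attached. All new weights are the constant `0`, so that this
operation performs no addition of weights. -/
def complete [DecidableEq V] [DecidableEq X] (R : Finset (FreeGroup X)) (Γ : WDigraph V X) :
    WDigraph (CVert V X) X where
  verts := Γ.verts.image CVert.old ∪ Γ.verts.biUnion fun v => R.biUnion fun r =>
    (Finset.range (r.norm + 1)).image (circuitVert v r)
  edges := Γ.edges.map (WEdge.map CVert.old) + ∑ v ∈ Γ.verts, ∑ r ∈ R,
    ∑ i : Fin r.toWord.length, {circuitEdge v r i, (circuitEdge v r i).inv}
  modulus := Γ.modulus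

end WDigraph

/-! ### Computations that count their arithmetic operations -/

/-- The result of a computation together with the number of arithmetic operations performed. -/
structure Counted (α : Type*) where
  val : α
  adds : ℕ

namespace Counted

variable {α β : Type*}

/-- No arithmetic. -/
def pure (a : α) : Counted α := ⟨a, 0⟩

/-- Sequential composition; the numbers of operations add up. -/
def bind (x : Counted α) (f : α → Counted β) : Counted β :=
  ⟨(f x.val).val, x.adds + (f x.val).adds⟩

/-- One addition. -/
def add (a b : ℤ) : Counted ℤ := ⟨a + b, 1⟩

/-- One subtraction, counted as an addition. -/
def sub (a b : ℤ) : Counted ℤ := ⟨a - b, 1⟩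

/-- The increment of a rank, counted as an addition. -/
def succ (k : ℕ) : Counted ℕ := ⟨k + 1, 1⟩

/-- The replacement of the modulus `N` by `gcd(N, d)`, counted as one more addition. -/
def gcd (N : ℕ) (d : ℤ) : Counted ℕ := ⟨Nat.gcd N d.natAbs, 1⟩

end Counted

/-! ### The weighted folding procedure -/

/-- Compressed trees with shifts: each vertex has a pointer `parent` (roots point to themselves) and
a shift value `shift`; roots carry a rank. The trees are the classes of identified vertices. -/
structure Forest (V : Type*) where
  parent : V → V
  shift : V → ℤ
  rank : V → ℕ

/-- Find with path compression. It returns the root of the tree of `v`, the total shift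
`Δ(v) = δ(v) + Δ(p(v))` (where `Δ = 0` at roots), and the forest in which all vertices on the path
from `v` point to the root and have their total shift as shift value.
The number `fuel` bounds the length of the path. -/
def Forest.find {V : Type*} [DecidableEq V] :
    (fuel : ℕ) → Forest V → V → Counted (V × ℤ × Forest V)
  | 0, F, v => Counted.pure (v, 0, F)
  | fuel + 1, F, v =>
    if F.parent v = v then Counted.pure (v, 0, F)
    else (Forest.find fuel F (F.parent v)).bind fun res =>
      (Counted.add (F.shift v) res.2.1).bind fun d =>
        Counted.pure (res.1, d,
          { res.2.2 with
            parent := Function.update res.2.2.parent v res.1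
            shift := Function.update res.2.2.shift v d })

/-- The state of the folding procedure. `out v` lists, for a root `v`, those processed edges that
leave the class of `v` and have not been removed; `pending` are the edges still to be processed.
Edges are kept with their original endpoints and weights. -/
structure FoldState (V X : Type*) where
  forest : Forest V
  out : V → List (WEdge V X)
  pending : List (WEdge V X)
  modulus : ℕ

namespace FoldState

variable {V X : Type*} [DecidableEq V] [DecidableEq X]

/-- The start: every vertex is its own class and all edges are pending. -/
def init (es : List (WEdge V X)) (N : ℕ) : FoldState V X where
  forest := ⟨id, fun _ => 0, fun _ => 0⟩
  out := fun _ => []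
  pending := es
  modulus := N

/-- The edge of the current graph that comes from the original edge `e`: its endpoints are the roots
of the endpoints of `e`, and its weight is `γ(e) + Δ(origin) - Δ(terminus)`. -/
def locate (n : ℕ) (F : Forest V) (e : WEdge V X) : Counted (WEdge V X × Forest V) :=
  (F.find n e.src).bind fun s =>
    (s.2.2.find n e.tgt).bind fun t =>
      (Counted.add e.wt s.2.1).bind fun k =>
        (Counted.sub k t.2.1).bind fun w =>
          Counted.pure (⟨s.1, e.lab, w, t.1⟩, t.2.2)

/-- Make the root `c` a child of the root `p`, with shift value `δ`. The edges leaving `c` now leave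
`p`; those whose label already occurs at `p` have to be processed again. -/
def attach (s : FoldState V X) (c p : V) (δ : ℤ) : Counted (FoldState V X) :=
  (if s.forest.rank c = s.forest.rank p then Counted.succ (s.forest.rank p)
    else Counted.pure (s.forest.rank p)).bind fun k =>
    Counted.pure
      { s with
        forest :=
          { parent := Function.update s.forest.parent c p
            shift := Function.update s.forest.shift c δ
            rank := Function.update s.forest.rank p k }
        out := Function.update
          (Function.update s.out p
            (s.out p ++ (s.out c).filter fun f => ∀ g ∈ s.out p, g.lab ≠ f.lab))
          c []
        pending := ((s.out c).filter fun f => ∃ g ∈ s.out p, g.lab = f.lab) ++ s.pending }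

/-- Fold the current edges `e₁` and `e₂`, which have the same origin and label, and of which `e₂` has
already been dropped. Distinct termini are merged by rank. -/
def foldPair (s : FoldState V X) (e₁ e₂ : WEdge V X) : Counted (FoldState V X) :=
  if e₁.tgt = e₂.tgt then
    (Counted.sub e₂.wt e₁.wt).bind fun d =>
      (Counted.gcd s.modulus d).bind fun N => Counted.pure { s with modulus := N }
  else if s.forest.rank e₁.tgt ≤ s.forest.rank e₂.tgt then
    (Counted.sub e₁.wt e₂.wt).bind fun δ => s.attach e₁.tgt e₂.tgt δ
  else
    (Counted.sub e₂.wt e₁.wt).bind fun δ => s.attach e₂.tgt e₁.tgt δ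

/-- Process one pending edge: if no processed edge with the same label leaves the class of its
origin then keep it, otherwise fold it with that edge. -/
def step (n : ℕ) (s : FoldState V X) : Counted (FoldState V X) :=
  match s.pending with
  | [] => Counted.pure s
  | e :: rest =>
    (locate n s.forest e).bind fun c₂ =>
      match (s.out c₂.1.src).find? fun f => f.lab = e.lab with
      | none =>
        Counted.pure
          { s with
            forest := c₂.2
            out := Function.update s.out c₂.1.src (e :: s.out c₂.1.src)
            pending := rest }
      | some f =>
        (locate n c₂.2 f).bind fun c₁ =>
          foldPair { s with forest := c₁.2, pending := rest } c₁.1 c₂.1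

/-- The first `k` iterations of the main loop. -/
def run (n : ℕ) : ℕ → FoldState V X → Counted (FoldState V X)
  | 0, s => Counted.pure s
  | k + 1, s => (step n s).bind (run n k)

/-- Compute the current form of a list of edges. -/
def locateAll (n : ℕ) : Forest V → List (WEdge V X) → Counted (List (WEdge V X))
  | _, [] => Counted.pure []
  | F, e :: es =>
    (locate n F e).bind fun c =>
      (locateAll n c.2 es).bind fun cs => Counted.pure (c.1 :: cs)

/-- Write down the resulting graph: its vertices are the roots, its edges are the remaining ones. -/
def output (vs : List V) (s : FoldState V X) : Counted (WDigraph V X) :=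
  (locateAll vs.length s.forest (vs.flatMap s.out)).bind fun es =>
    Counted.pure ⟨(vs.filter fun v => s.forest.parent v = v).toFinset, es, s.modulus⟩

end FoldState

/-- The folding procedure, applied to the graph with list of vertices `vs`, list of edges `es` and
modulus `N`, halts (its main loop runs until no edge is pending) with output `Δ` after exactly `c`
additions. -/
def FoldProcedure {V X : Type*} [DecidableEq V] [DecidableEq X]
    (vs : List V) (es : List (WEdge V X)) (N : ℕ) (Δ : WDigraph V X) (c : ℕ) : Prop :=
  ∃ k : ℕ,
    (FoldState.run vs.length k (FoldState.init es N)).val.pending = [] ∧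
    (FoldState.run vs.length k (FoldState.init es N)).bind (FoldState.output vs) = ⟨Δ, c⟩

/-! ### Levels of the Ackermann function -/

/-! Correctness and cost are proved together along the main loop. A state stands for the graph on
the roots whose edges are the live original edges in `WEdge.current` form. Each iteration leaves
this graph alone or performs one `FoldStep` on it. The processed edges at a root have distinct
labels, so the graph is folded once nothing is pending.

The number of iterations is controlled by `work`. A merger may send processed edges back to the
pending list, but only those whose label survives at the merged root; these are redundant and weigh
1 before and after. So every iteration lowers `work`, which starts at no more than 2|E|.

The cost is an amortized union-find analysis. Choose α with every rank below A(α, 0). A root of rank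
r has potential α(r + 2); once it is a child, it counts the iterates of A(k, ·), k < α, started at
r, that its parent's rank has not reached. Redirecting a vertex of a find path either passes a new
iterate, which lowers its potential, or uses up one of α levels (`childPotential_add_levelCount`).
The levels telescope along the path, so a find costs at most α (`Forest.Represents.find`), while a
link adds at most α because it raises one rank by at most 1. As links are charged directly, no count
of the vertices of a given rank is needed, and |S| suffices as a bound for ranks. Since the
completion has O(|Γ| L(R)) vertices and edges, α = `invAck` + 5 gives the claim. -/

theorem ack_succ_le_iterate (k x j : ℕ) : ack (k + 1) j ≤ (ack k)^[j + 2] x := by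
  induction j with
  | zero =>
    rw [ack_succ_zero]
    exact ack_mono_right k (Nat.succ_le_of_lt (ack_pos k x))
  | succ j ih =>
    rw [ack_succ_succ, Function.iterate_succ_apply']
    exact ack_mono_right k ih

/-- The level is one less than the first row of the Ackermann function that exceeds `R` at `r`. That
row is not row 0, because A(0, r) = r + 1 ≤ R. -/
theorem exists_level {α r R : ℕ} (h : r < R) (hα : R < ack α 0) :
    ∃ k < α, ack k r ≤ R ∧ R < ack (k + 1) r := by
  have hex : ∃ k, R < ack k r := ⟨α, hα.trans_le (ack_mono_right α (Nat.zero_le r))⟩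
  classical
  obtain ⟨k, hk⟩ : ∃ k, Nat.find hex = k + 1 := by
    refine Nat.exists_eq_succ_of_ne_zero fun h0 => ?_
    have := Nat.find_spec hex
    rw [h0, ack_zero] at this
    omega
  refine ⟨k, ?_, ?_, ?_⟩
  · have : Nat.find hex ≤ α :=
      Nat.find_min' hex (hα.trans_le (ack_mono_right α (Nat.zero_le r)))
    omega
  · exact not_lt.1 (Nat.find_min hex (by omega))
  · exact hk ▸ Nat.find_spec hex

/-- The potential of a child of rank `r` whose parent has rank `R`: the number of values
`(ack k)^[i] r`, where `k < α` and `0 < i ≤ r + 2`, that `R` has not yet reached. -/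
def childPotential (α r R : ℕ) : ℕ :=
  ((Finset.range α ×ˢ Finset.range (r + 2)).filter fun q => R < (ack q.1)^[q.2 + 1] r).card

theorem childPotential_le (α r R : ℕ) : childPotential α r R ≤ α * (r + 2) := by
  refine (Finset.card_filter_le _ _).trans ?_
  simp

theorem childPotential_anti (α r : ℕ) {R R' : ℕ} (h : R ≤ R') :
    childPotential α r R' ≤ childPotential α r R := by
  refine Finset.card_le_card fun q hq => ?_
  simp only [Finset.mem_filter] at hq ⊢
  exact ⟨hq.1, h.trans_lt hq.2⟩

/-- If the `j + 1`-st iterate of A(k, ·) at `r` is the last one not above `R`, then A(k, R) is at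
least the next one. Hence the pair `(k, j + 1)` is no longer counted for `R'`. It lies in the index
range since r + 2 iterations already reach A(k + 1, r) > R. -/
theorem childPotential_lt {α r R R' k : ℕ} (hk : k < α) (h₁ : ack k r ≤ R)
    (h₂ : R < ack (k + 1) r) (h : ack k R ≤ R') :
    childPotential α r R' < childPotential α r R := by
  classical
  have hex : ∃ i, R < (ack k)^[i + 1] r := ⟨r + 1, h₂.trans_le (ack_succ_le_iterate k r r)⟩
  obtain ⟨j, hj⟩ : ∃ j, Nat.find hex = j + 1 := by
    refine Nat.exists_eq_succ_of_ne_zero fun h0 => ?_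
    have := Nat.find_spec hex
    rw [h0] at this
    exact absurd h₁ (not_le.2 this)
  have hle : Nat.find hex ≤ r + 1 :=
    Nat.find_min' hex (h₂.trans_le (ack_succ_le_iterate k r r))
  have hlt := Nat.find_spec hex
  have hge : (ack k)^[j + 1] r ≤ R := not_lt.1 (Nat.find_min hex (by omega))
  rw [hj] at hlt hle
  have hR : R ≤ R' := (lt_ack_right k R).le.trans h
  refine Finset.card_lt_card (Finset.ssubset_iff_of_subset ?_ |>.2 ⟨(k, j + 1), ?_, ?_⟩)
  · intro q hq
    simp only [Finset.mem_filter] at hq ⊢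
    exact ⟨hq.1, hR.trans_lt hq.2⟩
  · simp only [Finset.mem_filter, Finset.mem_product, Finset.mem_range]
    exact ⟨⟨hk, by omega⟩, hlt⟩
  · simp only [Finset.mem_filter, not_and, not_lt]
    intro _
    rw [Function.iterate_succ_apply']
    exact (ack_mono_right k hge).trans h

/-- The number of levels `k < α` that lie between rank `r` and rank `R`. -/
def levelCount (α r R : ℕ) : ℕ := ((Finset.range α).filter fun k => ack k r ≤ R).card

theorem levelCount_le (α r R : ℕ) : levelCount α r R ≤ α :=
  (Finset.card_filter_le _ _).trans (Finset.card_range α).le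

theorem levelCount_anti (α R : ℕ) {r r' : ℕ} (h : r ≤ r') :
    levelCount α r' R ≤ levelCount α r R := by
  refine Finset.card_le_card fun k hk => ?_
  simp only [Finset.mem_filter] at hk ⊢
  exact ⟨hk.1, (ack_mono_right k h).trans hk.2⟩

/-- Linking a child of rank `r` from a parent of rank `p` to the root of rank `R` either lowers its
potential, or uses up a level. -/
theorem childPotential_add_levelCount {α r p R : ℕ} (h : r < p) (hp : p ≤ R) (hα : R < ack α 0) :
    1 + childPotential α r R + levelCount α p R ≤
      childPotential α r p + levelCount α r R := by
  obtain ⟨k, hk, h₁, h₂⟩ := exists_level h (hp.trans_lt hα)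
  -- `k` is the level between `r` and `p`. If A(k, p) ≤ R, an iterate of row `k` is passed;
  -- otherwise `k` counts for `r` but not for `p`.
  by_cases hkR : ack k p ≤ R
  · have := childPotential_lt hk h₁ h₂ hkR
    have := levelCount_anti α R h.le
    omega
  · have := childPotential_anti α r hp
    have : levelCount α p R < levelCount α r R := by
      refine Finset.card_lt_card (Finset.ssubset_iff_of_subset ?_ |>.2 ⟨k, ?_, ?_⟩)
      · intro q hq
        simp only [Finset.mem_filter] at hq ⊢
        exact ⟨hq.1, (ack_mono_right q h.le).trans hq.2⟩
      · simp only [Finset.mem_filter, Finset.mem_range]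
        exact ⟨hk, h₁.trans hp⟩
      · simp [hkR]
    omega

/-! ### Growth estimates for the inverse Ackermann function -/

theorem le_ack_invAck (n : ℕ) : n ≤ ack (invAck n) (invAck n) :=
  Nat.sInf_mem (s := {k : ℕ | n ≤ ack k k})
    ⟨n, (Nat.le_add_left n n).trans (add_lt_ack n n).le⟩

theorem invAck_pos {n : ℕ} (h : 2 ≤ n) : 0 < invAck n := by
  rcases Nat.eq_zero_or_pos (invAck n) with h0 | h0
  · have := le_ack_invAck n
    rw [h0, ack_zero] at this
    omega
  · exact h0

/-- Two rows above K = `invAck n` the argument 0 already beats A(K, K), as A(K + 2, 0) = A(K, A(K,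
1)) and A(K, 1) > K. One more row provides the start for two doublings, which give the factor 4. -/
theorem four_mul_lt_ack (n : ℕ) : 4 * n < ack (invAck n + 5) 0 := by
  have hn := le_ack_invAck n
  generalize invAck n = K at *
  have h1 (j : ℕ) : ack (j + 2) 0 = ack j (ack (j + 1) 0) := by
    rw [ack_succ_zero, ack_succ_succ]
  have h2 (j x : ℕ) : 2 * x + 3 ≤ ack (j + 2) x := by
    rw [← ack_two]
    exact ack_mono_left x (by omega)
  have h3 : n < ack (K + 2) 0 := by
    rw [h1]
    refine hn.trans_lt (ack_strictMono_right K ?_)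
    rw [ack_succ_zero]
    exact lt_ack_left K 1
  have h4 : ack (K + 2) 0 ≤ ack (K + 3) 0 := ack_mono_left 0 (by omega)
  have h5 := h2 K (ack (K + 3) 0)
  rw [← h1] at h5
  have h6 := h2 (K + 1) (ack (K + 4) 0)
  rw [← h1 (K + 1 + 2)] at h6
  have h7 : ack (K + 2 + 2) 0 = ack (K + 4) 0 := rfl
  have h8 : ack (K + 1 + 2 + 2) 0 = ack (K + 5) 0 := rfl
  omega

/-! ### Compressed forests -/

namespace Forest

variable {V : Type*} [DecidableEq V]

/-- `F` represents the partition of `S` in which `v` belongs to the class of the root `ρ v`, and has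
total shift `D v`. -/
structure Represents (F : Forest V) (S : Finset V) (ρ : V → V) (D : V → ℤ) : Prop where
  root : ∀ v, F.parent v = v → ρ v = v ∧ D v = 0
  child : ∀ v, F.parent v ≠ v →
    ρ (F.parent v) = ρ v ∧ D v = F.shift v + D (F.parent v) ∧ F.rank v < F.rank (F.parent v)
  parent_root : ∀ v, F.parent (ρ v) = ρ v
  rank_le : ∀ v, F.rank v ≤ F.rank (ρ v)
  mem : ∀ v, F.parent v ≠ v → v ∈ S
  root_mem : ∀ v ∈ S, ρ v ∈ S
  rank_le_card : ∀ v, F.rank v ≤ (S.filter fun v => ρ v ≠ v).card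

/-- The potential of a forest. -/
def potential (α : ℕ) (S : Finset V) (F : Forest V) : ℕ :=
  ∑ v ∈ S, if F.parent v = v then α * (F.rank v + 2)
    else childPotential α (F.rank v) (F.rank (F.parent v))

/-- Redirect `v` to `w`, with total shift `d`. -/
def redirect (F : Forest V) (v w : V) (d : ℤ) : Forest V :=
  { F with parent := Function.update F.parent v w, shift := Function.update F.shift v d }

/-- Make the root `c` a child of the root `p` with shift value `δ`, where `p` gets rank `k`. -/
def link (F : Forest V) (c p : V) (δ : ℤ) (k : ℕ) : Forest V where
  parent := Function.update F.parent c p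
  shift := Function.update F.shift c δ
  rank := Function.update F.rank p k

variable {F : Forest V} {S : Finset V} {ρ : V → V} {D : V → ℤ}

/-- The term of `c` does not grow, because the potential of a root dominates that of any child of
the same rank. The term of `p` grows by at most `α`, and the children of `p` only lose potential
when its rank rises. -/
theorem potential_link {c p : V} (δ : ℤ) {k : ℕ} (hc : F.parent c = c)
    (hp : F.parent p = p) (hpS : p ∈ S) (hne : c ≠ p) (hk : F.rank p ≤ k)
    (hk' : k ≤ F.rank p + 1) (α : ℕ) :
    (F.link c p δ k).potential α S ≤ F.potential α S + α := by
  have hsum : F.potential α S + α = ∑ v ∈ S, ((if F.parent v = v then α * (F.rank v + 2)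
      else childPotential α (F.rank v) (F.rank (F.parent v))) + if v = p then α else 0) := by
    rw [Finset.sum_add_distrib, Finset.sum_ite_eq' S p, if_pos hpS]
    rfl
  rw [hsum]
  refine Finset.sum_le_sum fun v _ => ?_
  rcases eq_or_ne v c with rfl | hvc
  · have hle := childPotential_le α (F.rank v) k
    simpa [Forest.link, hne, hne.symm, hc] using hle
  · rcases eq_or_ne v p with rfl | hvp
    · simp only [Forest.link, Function.update_of_ne hvc, Function.update_self, hp, if_true]
      nlinarith
    · simp only [Forest.link, Function.update_of_ne hvc, Function.update_of_ne hvp, hvp, if_false,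
        add_zero]
      split_ifs
      · exact le_rfl
      · refine childPotential_anti _ _ ?_
        rcases eq_or_ne (F.parent v) p with hq | hq
        · simpa [hq] using hk
        · simp [hq]

namespace Represents

theorem parent_eq_iff (h : F.Represents S ρ D) (v : V) : F.parent v = v ↔ ρ v = v :=
  ⟨fun hv => (h.root v hv).1, fun hv => by have := h.parent_root v; rwa [hv] at this⟩

theorem idem (h : F.Represents S ρ D) (v : V) : ρ (ρ v) = ρ v :=
  (h.root _ (h.parent_root v)).1

theorem shift_root (h : F.Represents S ρ D) (v : V) : D (ρ v) = 0 :=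
  (h.root _ (h.parent_root v)).2

theorem parent_le (h : F.Represents S ρ D) {v : V} (hv : F.parent v ≠ v) :
    F.rank (F.parent v) ≤ F.rank (ρ v) :=
  (h.child v hv).1 ▸ h.rank_le (F.parent v)

theorem rank_lt (h : F.Represents S ρ D) {v : V} (hv : F.parent v ≠ v) :
    F.rank v < F.rank (ρ v) :=
  (h.child v hv).2.2.trans_le (h.parent_le hv)

theorem rank_le_card' (h : F.Represents S ρ D) (v : V) : F.rank v ≤ S.card :=
  (h.rank_le_card v).trans (Finset.card_filter_le _ _)

theorem redirect (h : F.Represents S ρ D) {v : V} (hv : F.parent v ≠ v) :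
    (F.redirect v (ρ v) (D v)).Represents S ρ D := by
  have hρ : ρ v ≠ v := fun h' => hv ((h.parent_eq_iff v).2 h')
  refine ⟨fun w hw => ?_, fun w hw => ?_, fun w => ?_, h.rank_le, fun w hw => ?_, h.root_mem,
    h.rank_le_card⟩
  · rcases eq_or_ne w v with rfl | hwv
    · simp [Forest.redirect, hρ] at hw
    · exact h.root w (by simpa [Forest.redirect, hwv] using hw)
  · rcases eq_or_ne w v with rfl | hwv
    · simp [Forest.redirect, h.idem, h.shift_root, h.rank_lt hv]
    · simpa [Forest.redirect, hwv] using h.child w (by simpa [Forest.redirect, hwv] using hw)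
  · have : ρ w ≠ v := fun h' => hρ (by rw [← h', h.idem])
    simp [Forest.redirect, this, h.parent_root]
  · rcases eq_or_ne w v with rfl | hwv
    · exact h.mem w hv
    · exact h.mem w (by simpa [Forest.redirect, hwv] using hw)

theorem potential_redirect (h : F.Represents S ρ D) {v : V} (hv : F.parent v ≠ v) (α : ℕ) :
    (F.redirect v (ρ v) (D v)).potential α S + childPotential α (F.rank v) (F.rank (F.parent v)) =
      F.potential α S + childPotential α (F.rank v) (F.rank (ρ v)) := by
  have hρ : ρ v ≠ v := fun h' => hv ((h.parent_eq_iff v).2 h')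
  have hS := h.mem v hv
  unfold potential
  rw [← Finset.add_sum_erase S _ hS, ← Finset.add_sum_erase S _ hS]
  have : ∀ w ∈ S.erase v, (if (F.redirect v (ρ v) (D v)).parent w = w
      then α * ((F.redirect v (ρ v) (D v)).rank w + 2)
      else childPotential α ((F.redirect v (ρ v) (D v)).rank w)
        ((F.redirect v (ρ v) (D v)).rank ((F.redirect v (ρ v) (D v)).parent w))) =
      if F.parent w = w then α * (F.rank w + 2)
      else childPotential α (F.rank w) (F.rank (F.parent w)) := by
    intro w hw
    simp [Forest.redirect, (Finset.mem_erase.1 hw).1]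
  rw [Finset.sum_congr rfl this]
  simp only [Forest.redirect, Function.update_self, hρ, hv, if_false]
  omega

/-- Induction along the path: the level term on the right telescopes, so the whole path shares the
levels between the rank of `v` and that of its root. Ranks increase strictly towards the root, so
the rank difference bounds the fuel needed. -/
theorem find (n : ℕ) (h : F.Represents S ρ D) {α : ℕ} (hα : S.card < ack α 0) (v : V)
    (hn : F.rank (ρ v) ≤ F.rank v + n) :
    ∃ F' : Forest V, (F.find n v).val = (ρ v, D v, F') ∧ F'.Represents S ρ D ∧
      F'.rank = F.rank ∧ (∀ w, F.rank w < F.rank v → F'.parent w = F.parent w) ∧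
      (F.find n v).adds + F'.potential α S ≤
        F.potential α S + levelCount α (F.rank v) (F.rank (ρ v)) := by
  induction n generalizing v with
  | zero =>
    have hv : F.parent v = v := by
      by_contra hv
      have := h.rank_lt hv
      omega
    obtain ⟨h1, h2⟩ := h.root v hv
    refine ⟨F, ?_, h, rfl, fun _ _ => rfl, ?_⟩
    · simp [Forest.find, Counted.pure, h1, h2]
    · simp [Forest.find, Counted.pure]
  | succ n ih =>
    by_cases hv : F.parent v = v
    · obtain ⟨h1, h2⟩ := h.root v hv
      refine ⟨F, ?_, h, rfl, fun _ _ => rfl, ?_⟩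
      · simp [Forest.find, Counted.pure, h1, h2, hv]
      · simp [Forest.find, Counted.pure, hv]
    · obtain ⟨h1, h2, h3⟩ := h.child v hv
      obtain ⟨F', hval, hF', hrank, hpar, hcost⟩ := ih (F.parent v) (by rw [h1]; omega)
      -- Compressing the path from the parent touches only vertices of rank at least that of the
      -- parent, so the pointer of `v` is intact.
      have hpv := hpar v h3
      have hv' : F'.parent v ≠ v := by rwa [hpv]
      refine ⟨F'.redirect v (ρ v) (D v), ?_, hF'.redirect hv', hrank, fun w hw => ?_, ?_⟩
      · simp only [Forest.find, hv, if_false, Counted.bind, Counted.pure, Counted.add, hval, h1,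
          ← h2]
        rfl
      · have hwv : w ≠ v := by rintro rfl; omega
        simp only [Forest.redirect, Function.update_of_ne hwv]
        exact hpar w (hw.trans h3)
      · have hpot := hF'.potential_redirect hv' α
        have hadds : (F.find (n + 1) v).adds = (F.find n (F.parent v)).adds + 1 := by
          simp [Forest.find, hv, Counted.bind, Counted.pure, Counted.add]
        have hkey := childPotential_add_levelCount (α := α) h3 (h.parent_le hv)
          ((h.rank_le_card' _).trans_lt hα)
        rw [hrank, hpv] at hpot
        rw [h1] at hcost
        omega

theorem link (h : F.Represents S ρ D) {c p : V} (δ : ℤ) {k : ℕ} (hc : F.parent c = c)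
    (hp : F.parent p = p) (hcS : c ∈ S) (hpS : p ∈ S) (hne : c ≠ p) (hk : F.rank p ≤ k)
    (hk' : k ≤ F.rank p + 1) (hck : F.rank c < k) :
    (F.link c p δ k).Represents S (fun v => glue c p (ρ v))
      (fun v => D v + if ρ v = c then δ else 0) := by
  have hρc := (h.root c hc).1
  have hρp := (h.root p hp).1
  have hmono : ∀ v, F.rank v ≤ (F.link c p δ k).rank v := by
    intro v
    rcases eq_or_ne v p with rfl | hv
    · simpa [Forest.link] using hk
    · simp [Forest.link, hv]
  have hrankp : (F.link c p δ k).rank p = k := by simp [Forest.link]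
  have hrank : ∀ v, v ≠ p → (F.link c p δ k).rank v = F.rank v := by
    intro v hv
    simp [Forest.link, hv]
  have hparc : (F.link c p δ k).parent c = p := by simp [Forest.link]
  have hpar : ∀ v, v ≠ c → (F.link c p δ k).parent v = F.parent v := by
    intro v hv
    simp [Forest.link, hv]
  have hne_root : ∀ v, F.parent v ≠ v → v ≠ c ∧ v ≠ p :=
    fun v hv => ⟨fun h' => hv (h' ▸ hc), fun h' => hv (h' ▸ hp)⟩
  refine ⟨fun v hv => ?_, fun v hv => ?_, fun v => ?_, fun v => ?_, fun v hv => ?_, fun v hv => ?_,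
    fun v => ?_⟩
  · have hvc : v ≠ c := by rintro rfl; exact hne (hparc ▸ hv).symm
    rw [hpar v hvc] at hv
    simp [glue, h.root v hv, hvc]
  · rcases eq_or_ne v c with rfl | hvc
    · simp only [hparc, hρp, hρc, glue, hne.symm, if_false, if_true, hrankp, hrank v hne, true_and,
        (h.root p hp).2, (h.root v hc).2]
      refine ⟨?_, hck⟩
      simp [Forest.link]
    · rw [hpar v hvc] at hv ⊢
      obtain ⟨h1, h2, h3⟩ := h.child v hv
      refine ⟨by rw [h1], ?_, ?_⟩
      · simp only [h1, h2, Forest.link, Function.update_of_ne hvc]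
        ring
      · rw [hrank v (hne_root v hv).2]
        exact h3.trans_le (hmono _)
  · by_cases hv : ρ v = c
    · simp [glue, hv, hpar p hne.symm, hp]
    · simp [glue, hv, hpar _ hv, h.parent_root]
  · by_cases hv : ρ v = c
    · simp only [glue, hv, if_true, hrankp]
      rcases eq_or_ne v p with rfl | hvp
      · exact hrankp.le
      · rw [hrank v hvp]
        have := h.rank_le v
        rw [hv] at this
        omega
    · simp only [glue, hv, if_false]
      rcases eq_or_ne v p with rfl | hvp
      · rw [hρp]
      · rw [hrank v hvp]
        exact (h.rank_le v).trans (hmono _)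
  · rcases eq_or_ne v c with rfl | hvc
    · exact hcS
    · exact h.mem v (by rwa [hpar v hvc] at hv)
  · by_cases hv' : ρ v = c
    · simpa [glue, hv'] using hpS
    · simpa [glue, hv'] using h.root_mem v hv
  · have hle : F.rank v + 1 ≤ (S.filter fun v => glue c p (ρ v) ≠ v).card := by
      refine lt_of_le_of_lt (h.rank_le_card v) (Finset.card_lt_card
        (Finset.ssubset_iff_of_subset ?_ |>.2 ⟨c, ?_, ?_⟩))
      · intro w hw
        simp only [Finset.mem_filter] at hw ⊢
        refine ⟨hw.1, ?_⟩
        by_cases hwc : ρ w = c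
        · simp only [glue, hwc, if_true]
          rintro rfl
          exact hne (hwc ▸ hρp)
        · simpa [glue, hwc] using hw.2
      · simp only [Finset.mem_filter]
        exact ⟨hcS, by simp [glue, hρc, hne.symm]⟩
      · simp [hρc]
    rcases eq_or_ne v p with rfl | hv
    · rw [hrankp]
      omega
    · rw [hrank v hv]
      omega

end Represents

end Forest

/-! ### The graph represented by a state of the folding procedure -/

namespace WEdge

variable {V X : Type*}

/-- The current form of an edge, given the roots `ρ` and total shifts `D` of the vertices. -/
def current (ρ : V → V) (D : V → ℤ) (e : WEdge V X) : WEdge V X :=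
  ⟨ρ e.src, e.lab, e.wt + D e.src - D e.tgt, ρ e.tgt⟩

/-- Shifting at a root and gluing it amounts to updating `ρ` and `D`; stored edges need not change.
For loops at `c` the two shift terms cancel. -/
theorem map_glue_shift_current [DecidableEq V] (ρ : V → V) (D : V → ℤ) (c p : V) (δ : ℤ)
    (e : WEdge V X) :
    ((e.current ρ D).shift c δ).map (glue c p) =
      e.current (fun v => glue c p (ρ v)) fun v => D v + if ρ v = c then δ else 0 := by
  by_cases h₁ : ρ e.src = c <;> by_cases h₂ : ρ e.tgt = c <;>
    simp [map, shift, current, h₁, h₂] <;> ring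

end WEdge

namespace FoldState

variable {V X : Type*} [DecidableEq V]
variable {S : Finset V} {ρ : V → V} {D : V → ℤ}

/-- Two finds of amortized cost `α` each, and two additions for the weight. -/
theorem locate_represents {F : Forest V} (h : F.Represents S ρ D) {α n : ℕ}
    (hα : S.card < ack α 0) (hn : S.card ≤ n) (e : WEdge V X) :
    ∃ F' : Forest V, (locate n F e).val = (e.current ρ D, F') ∧ F'.Represents S ρ D ∧
      (locate n F e).adds + F'.potential α S ≤ F.potential α S + (2 * α + 2) := by
  have hfuel : ∀ {F : Forest V}, F.Represents S ρ D → ∀ v, F.rank (ρ v) ≤ F.rank v + n :=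
    fun h v => (h.rank_le_card' _).trans (by omega)
  obtain ⟨F₁, hv₁, h₁, -, -, hc₁⟩ := h.find n hα e.src (hfuel h _)
  obtain ⟨F₂, hv₂, h₂, -, -, hc₂⟩ := h₁.find n hα e.tgt (hfuel h₁ _)
  have hl₁ := levelCount_le α (F.rank e.src) (F.rank (ρ e.src))
  have hl₂ := levelCount_le α (F₁.rank e.tgt) (F₁.rank (ρ e.tgt))
  refine ⟨F₂, ?_, h₂, ?_⟩
  · simp only [locate, Counted.bind, Counted.add, Counted.sub, Counted.pure, hv₁, hv₂]
    rfl
  · simp only [locate, Counted.bind, Counted.add, Counted.sub, Counted.pure, hv₁]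
    omega

theorem locateAll_represents {F : Forest V} (h : F.Represents S ρ D) {α n : ℕ}
    (hα : S.card < ack α 0) (hn : S.card ≤ n) (es : List (WEdge V X)) :
    (locateAll n F es).val = es.map (WEdge.current ρ D) ∧
      (locateAll n F es).adds ≤ F.potential α S + es.length * (2 * α + 2) := by
  induction es generalizing F with
  | nil => simp [locateAll, Counted.pure]
  | cons e es ih =>
    obtain ⟨F', hv, h', hc⟩ := locate_represents h hα hn e
    obtain ⟨ih₁, ih₂⟩ := ih h'
    simp only [locateAll, Counted.bind, Counted.pure, hv, ih₁, List.map_cons, List.length_cons,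
      true_and]
    rw [Nat.succ_mul]
    omega

/-- The processed edges that have not been removed. -/
def kept (S : Finset V) (s : FoldState V X) : Multiset (WEdge V X) :=
  ∑ v ∈ S, (s.out v : Multiset (WEdge V X))

/-- The edges that have not been removed. -/
def live (S : Finset V) (s : FoldState V X) : Multiset (WEdge V X) :=
  (s.pending : Multiset (WEdge V X)) + s.kept S

/-- The graph represented by a state. -/
def graph (S : Finset V) (s : FoldState V X) (ρ : V → V) (D : V → ℤ) : WDigraph V X where
  verts := S.image ρ
  edges := (s.live S).map (WEdge.current ρ D)
  modulus := s.modulus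

/-- Adding the old list on the left avoids multiset subtraction. -/
theorem sum_update_add {f : V → List (WEdge V X)} {v : V} (hv : v ∈ S) (l : List (WEdge V X)) :
    (∑ w ∈ S, (Function.update f v l w : Multiset (WEdge V X))) + (f v : Multiset (WEdge V X)) =
      (∑ w ∈ S, (f w : Multiset (WEdge V X))) + (l : Multiset (WEdge V X)) := by
  rw [← Finset.add_sum_erase S _ hv,
    ← Finset.add_sum_erase S (fun w => (f w : Multiset (WEdge V X))) hv,
    Finset.sum_congr rfl fun w hw => by rw [Function.update_of_ne (Finset.ne_of_mem_erase hw)]]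
  simp only [Function.update_self]
  rw [add_right_comm, add_comm (l : Multiset (WEdge V X)), add_right_comm]

variable [DecidableEq X]

/-- A processed edge with the label of `e` leaves the class of the origin of `e`. -/
def Redundant (s : FoldState V X) (ρ : V → V) (e : WEdge V X) : Prop :=
  ∃ g ∈ s.out (ρ e.src), g.lab = e.lab

instance (s : FoldState V X) (ρ : V → V) (e : WEdge V X) : Decidable (s.Redundant ρ e) :=
  inferInstanceAs (Decidable (∃ g ∈ s.out (ρ e.src), g.lab = e.lab))

/-- A bound for the number of remaining iterations of the main loop: pending edges that will be
folded count once, the other pending edges count twice, and processed edges count once. -/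
def work (S : Finset V) (s : FoldState V X) (ρ : V → V) : ℕ :=
  (s.pending.map fun e => if s.Redundant ρ e then 1 else 2).sum + (s.kept S).card

/-- The state `s` represents a graph that is reached from `Γ` by folds. -/
structure Invariant (S : Finset V) (Γ : WDigraph V X) (s : FoldState V X) (ρ : V → V)
    (D : V → ℤ) : Prop where
  represents : s.forest.Represents S ρ D
  incident : ∀ e ∈ s.live S, e.src ∈ S ∧ e.tgt ∈ S
  root : ∀ v, ∀ e ∈ s.out v, v ∈ S ∧ ρ e.src = v
  nodup : ∀ v, ((s.out v).map WEdge.lab).Nodup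
  reach : Relation.ReflTransGen WDigraph.FoldStep Γ (s.graph S ρ D)

omit [DecidableEq V] in
theorem sum_le_sum_of_redundant {s s' : FoldState V X} {ρ ρ' : V → V} (l : List (WEdge V X))
    (h : ∀ e ∈ l, s.Redundant ρ e → s'.Redundant ρ' e) :
    (l.map fun e => if s'.Redundant ρ' e then 1 else 2).sum ≤
      (l.map fun e => if s.Redundant ρ e then 1 else 2).sum := by
  refine List.sum_le_sum fun e he => ?_
  have := h e he
  split_ifs <;> first | omega | tauto

/-- Fold of two edges with distinct termini, in terms of representing forests. -/
theorem foldStep_glue {T : Finset V} {M : Multiset (WEdge V X)} {N : ℕ} {e₁ e₂ : WEdge V X}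
    (hlab : e₁.lab = e₂.lab) (hsrc : ρ e₁.src = ρ e₂.src) (hne : ρ e₁.tgt ≠ ρ e₂.tgt) {δ : ℤ}
    (hδ : δ = (e₁.current ρ D).wt - (e₂.current ρ D).wt)
    {ρ' : V → V} (hρ' : ρ' = fun v => glue (ρ e₁.tgt) (ρ e₂.tgt) (ρ v))
    {D' : V → ℤ} (hD' : D' = fun v => D v + if ρ v = ρ e₁.tgt then δ else 0) :
    WDigraph.FoldStep ⟨T.image ρ, (e₁ ::ₘ e₂ ::ₘ M).map (WEdge.current ρ D), N⟩
      ⟨T.image ρ', (e₁ ::ₘ M).map (WEdge.current ρ' D'), N⟩ ∧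
    e₁.current ρ' D' = e₂.current ρ' D' := by
  subst hρ' hD'
  constructor
  · have h := WDigraph.FoldStep.merge
      ⟨T.image ρ, (e₁ ::ₘ e₂ ::ₘ M).map (WEdge.current ρ D), N⟩ (ρ e₁.src) (ρ e₁.tgt) (ρ e₂.tgt)
      e₁.lab (e₁.current ρ D).wt (e₂.current ρ D).wt (by simp [WEdge.current])
      (by simp [WEdge.current, hlab, hsrc]) hne
    rw [← hδ] at h
    convert h using 1
    refine WDigraph.mk.injEq .. |>.mpr ⟨?_, ?_, rfl⟩
    · simp [WDigraph.identify, WDigraph.shift, Finset.image_image, Function.comp_def]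
    · have h2 : (⟨ρ e₁.src, e₁.lab, (e₂.current ρ D).wt, ρ e₂.tgt⟩ : WEdge V X) =
          e₂.current ρ D := by simp [WEdge.current, hlab, hsrc]
      rw [h2, WEdge.map_glue_shift_current]
      simp only [WDigraph.identify, WDigraph.shift, Multiset.map_map, Function.comp_def,
        WEdge.map_glue_shift_current]
      -- The erased edge is the image of `e₂`; bringing it to the front leaves `e₁ ::ₘ M`.
      rw [Multiset.map_cons, Multiset.map_cons, Multiset.map_cons, Multiset.cons_swap,
        Multiset.erase_cons_head]
  · simp only [WEdge.current, WEdge.mk.injEq, hlab, hsrc, true_and, hδ, glue, hne.symm, if_true,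
      if_false, and_true]
    ring

/-! ### Effect of the elementary moves on the invariant and on `work` -/

namespace Invariant

variable {Γ : WDigraph V X} {s : FoldState V X} {e f : WEdge V X} {rest : List (WEdge V X)}

theorem set_forest (h : s.Invariant S Γ ρ D) {F : Forest V} (hF : F.Represents S ρ D) :
    ({ s with forest := F } : FoldState V X).Invariant S Γ ρ D :=
  ⟨hF, h.incident, h.root, h.nodup, h.reach⟩

/-- Only the bookkeeping changes, not the graph. A non-redundant pending edge of weight 2 becomes a
processed edge of weight 1. -/
theorem keep (h : s.Invariant S Γ ρ D) (hp : s.pending = e :: rest)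
    (he : ¬ s.Redundant ρ e) :
    ({ s with out := Function.update s.out (ρ e.src) (e :: s.out (ρ e.src)), pending := rest } :
        FoldState V X).Invariant S Γ ρ D ∧
      work S { s with
        out := Function.update s.out (ρ e.src) (e :: s.out (ρ e.src))
        pending := rest } ρ + 1 ≤ s.work S ρ := by
  have heS : e.src ∈ S := (h.incident e (by simp [live, hp])).1
  have hr := h.represents.root_mem _ heS
  set s' : FoldState V X := { s with
    out := Function.update s.out (ρ e.src) (e :: s.out (ρ e.src)), pending := rest } with hs'
  have hkept : s'.kept S = e ::ₘ s.kept S := by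
    have := sum_update_add (f := s.out) hr (e :: s.out (ρ e.src))
    rw [← Multiset.cons_coe, Multiset.add_cons, ← Multiset.cons_add] at this
    exact add_right_cancel this
  have hlive : s'.live S = s.live S := by
    have : s'.pending = rest := rfl
    rw [live, live, hkept, hp, this, ← Multiset.cons_coe, Multiset.add_cons, Multiset.cons_add]
  refine ⟨⟨h.represents, hlive ▸ h.incident, fun v g hg => ?_, fun v => ?_, ?_⟩, ?_⟩
  · rcases eq_or_ne v (ρ e.src) with rfl | hv
    · simp only [hs', Function.update_self, List.mem_cons] at hg
      rcases hg with rfl | hg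
      · exact ⟨hr, rfl⟩
      · exact h.root _ _ hg
    · exact h.root v g (by simpa [hs', hv] using hg)
  · rcases eq_or_ne v (ρ e.src) with rfl | hv
    · simp only [hs', Function.update_self, List.map_cons, List.nodup_cons]
      refine ⟨fun hm => he ?_, h.nodup _⟩
      obtain ⟨g, hg, hgl⟩ := List.mem_map.1 hm
      exact ⟨g, hg, hgl⟩
    · simpa [hs', hv] using h.nodup v
  · have : s'.graph S ρ D = s.graph S ρ D := by rw [graph, graph, hlive]
    rw [this]
    exact h.reach
  · have hsum := sum_le_sum_of_redundant (s := s) (s' := s') (ρ := ρ) (ρ' := ρ) rest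
      (fun g _ ⟨k, hk, hkl⟩ => ⟨k, by
        rcases eq_or_ne (ρ g.src) (ρ e.src) with hv | hv
        · rw [hv] at hk ⊢
          simp [hs', hk]
        · simpa [hs', hv] using hk, hkl⟩)
    simp only [work, hp, hkept, Multiset.card_cons, List.map_cons, List.sum_cons, if_neg he]
    have : s'.pending = rest := rfl
    rw [this]
    omega

theorem exists_live_eq (h : s.Invariant S Γ ρ D) (hp : s.pending = e :: rest)
    (hf : f ∈ s.out (ρ e.src)) : ∃ M, s.live S = e ::ₘ f ::ₘ M ∧
      live S { s with pending := rest } = f ::ₘ M := by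
  have hmem : f ∈ live S { s with pending := rest } := by
    simp only [live, Multiset.mem_add]
    refine Or.inr (Multiset.mem_sum.2 ⟨ρ e.src, (h.root _ _ hf).1, by simpa using hf⟩)
  obtain ⟨M, hM⟩ := Multiset.exists_cons_of_mem hmem
  refine ⟨M, ?_, hM⟩
  rw [← hM]
  simp [live, hp, ← Multiset.cons_coe, kept]

theorem remove (h : s.Invariant S Γ ρ D) (hp : s.pending = e :: rest) (hf : f ∈ s.out (ρ e.src))
    (hlab : f.lab = e.lab) (htgt : ρ f.tgt = ρ e.tgt) :
    ({ s with
      pending := rest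
      modulus := Nat.gcd s.modulus ((e.current ρ D).wt - (f.current ρ D).wt).natAbs } :
        FoldState V X).Invariant S Γ ρ D ∧
      work S { s with
        pending := rest
        modulus := Nat.gcd s.modulus ((e.current ρ D).wt - (f.current ρ D).wt).natAbs } ρ + 1 ≤
        s.work S ρ := by
  obtain ⟨M, hM, hM'⟩ := h.exists_live_eq hp hf
  have hsrc := (h.root _ _ hf).2
  refine ⟨⟨h.represents, fun g hg => h.incident g ?_, h.root, h.nodup, h.reach.tail ?_⟩, ?_⟩
  · have hg' : g ∈ live S { s with pending := rest } := hg
    rw [hM'] at hg'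
    rw [hM]
    exact Multiset.mem_cons_of_mem hg'
  · have := WDigraph.FoldStep.remove (s.graph S ρ D) (ρ e.src) (ρ e.tgt) e.lab (f.current ρ D).wt
      (e.current ρ D).wt (M.map (WEdge.current ρ D))
      (by
        simp only [graph, hM, Multiset.map_cons]
        rw [Multiset.cons_swap]
        congr 1
        simp [WEdge.current, hsrc, hlab, htgt])
    convert this using 1
    refine WDigraph.mk.injEq .. |>.mpr ⟨rfl, ?_, rfl⟩
    change (live S { s with pending := rest }).map _ = _
    rw [hM', Multiset.map_cons]
    congr 1
    simp [WEdge.current, hsrc, hlab, htgt]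
  · have he : s.Redundant ρ e := ⟨f, hf, hlab⟩
    simp only [work, hp, List.map_cons, List.sum_cons, if_pos he]
    have := sum_le_sum_of_redundant (s := s) (s' := { s with
        pending := rest
        modulus := Nat.gcd s.modulus ((e.current ρ D).wt - (f.current ρ D).wt).natAbs })
        (ρ := ρ) (ρ' := ρ) rest (fun _ _ hg => hg)
    simp only [kept] at this ⊢
    omega

/-- The dropped edge `e` was redundant and accounts for the loss of 1 in `work`. The edges sent back
from `c` keep weight 1, and redundancy of the other pending edges survives the merger. -/
theorem attach (h : s.Invariant S Γ ρ D) (hp : s.pending = e :: rest) (he : s.Redundant ρ e)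
    {c p : V} (hc : ρ c = c) (hpr : ρ p = p) (hcS : c ∈ S) (hpS : p ∈ S) (hne : c ≠ p) {δ : ℤ}
    (hle : s.forest.rank c ≤ s.forest.rank p)
    (hfold : WDigraph.FoldStep (s.graph S ρ D)
      (graph S { s with pending := rest } (fun v => glue c p (ρ v))
        fun v => D v + if ρ v = c then δ else 0)) (α : ℕ) :
    ((FoldState.attach { s with pending := rest } c p δ).val.Invariant S Γ (fun v => glue c p (ρ v))
      fun v => D v + if ρ v = c then δ else 0) ∧
    (FoldState.attach { s with pending := rest } c p δ).val.work S (fun v => glue c p (ρ v)) + 1 ≤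
      s.work S ρ ∧
    (FoldState.attach { s with pending := rest } c p δ).adds +
        (FoldState.attach { s with pending := rest } c p δ).val.forest.potential α S ≤
      s.forest.potential α S + (α + 1) := by
  have hc' := (h.represents.parent_eq_iff c).2 hc
  have hp' := (h.represents.parent_eq_iff p).2 hpr
  set k := if s.forest.rank c = s.forest.rank p then s.forest.rank p + 1 else s.forest.rank p
    with hkdef
  have hk₁ : s.forest.rank p ≤ k := by rw [hkdef]; split_ifs <;> omega
  have hk₂ : k ≤ s.forest.rank p + 1 := by rw [hkdef]; split_ifs <;> omega
  have hk₃ : s.forest.rank c < k := by rw [hkdef]; split_ifs <;> omega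
  set A := (s.out c).filter fun f => ∀ g ∈ s.out p, g.lab ≠ f.lab with hA
  set B := (s.out c).filter fun f => ∃ g ∈ s.out p, g.lab = f.lab with hB
  have hval : (FoldState.attach { s with pending := rest } c p δ).val =
      { s with
        forest := s.forest.link c p δ k
        out := Function.update (Function.update s.out p (s.out p ++ A)) c []
        pending := B ++ rest } := by
    simp only [FoldState.attach, Counted.bind, Counted.pure, hkdef]
    split_ifs <;> rfl
  have hadds : (FoldState.attach { s with pending := rest } c p δ).adds ≤ 1 := by
    simp only [FoldState.attach, Counted.bind, Counted.pure, Counted.succ]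
    split_ifs <;> simp
  rw [hval]
  set s' : FoldState V X := { s with
    forest := s.forest.link c p δ k
    out := Function.update (Function.update s.out p (s.out p ++ A)) c []
    pending := B ++ rest } with hs'
  -- `A` moves to the list of `p` and `B` returns to the pending edges, so no live edge is lost or
  -- duplicated.
  have hAB : (s.out c : Multiset (WEdge V X)) = A + B := by
    have := Multiset.filter_add_not (fun f => ∃ g ∈ s.out p, g.lab = f.lab)
      (s.out c : Multiset (WEdge V X))
    rw [← this, add_comm]
    simp [hA, hB, Multiset.filter_coe]
  have hkept : s'.kept S + B = s.kept S := by
    have h₁ := sum_update_add (f := Function.update s.out p (s.out p ++ A)) hcS []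
    have h₂ := sum_update_add (f := s.out) hpS (s.out p ++ A)
    rw [← Multiset.coe_add, add_comm (s.out p : Multiset (WEdge V X)) (A : Multiset (WEdge V X)), ← add_assoc] at h₂
    rw [add_right_cancel h₂, Function.update_of_ne hne, hAB, add_comm (A : Multiset (WEdge V X)),
      ← add_assoc, Multiset.coe_nil, add_zero] at h₁
    exact add_right_cancel h₁
  have hlive : s'.live S = live S { s with pending := rest } := by
    have hk' : kept S { s with pending := rest } = s.kept S := rfl
    simp only [live, hk', ← hkept]
    simp only [hs', ← Multiset.coe_add]
    abel
  have houtp : s'.out p = s.out p ++ A := by simp [hs', hne.symm]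
  have houtc : s'.out c = [] := by simp [hs']
  have hout : ∀ v, v ≠ c → v ≠ p → s'.out v = s.out v := fun v h1 h2 => by simp [hs', h1, h2]
  have hred : ∀ g ∈ s.out c, ∃ g' ∈ s'.out p, g'.lab = g.lab := by
    intro g hg
    rw [houtp]
    by_cases hd : ∃ g' ∈ s.out p, g'.lab = g.lab
    · obtain ⟨g', hg', hl⟩ := hd
      exact ⟨g', List.mem_append_left _ hg', hl⟩
    · push Not at hd
      exact ⟨g, List.mem_append_right _ (List.mem_filter.2 ⟨hg, by simpa using hd⟩), rfl⟩
  refine ⟨⟨?_, fun g hg => h.incident g ?_, fun v g hg => ?_, fun v => ?_, h.reach.tail ?_⟩, ?_, ?_⟩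
  · exact h.represents.link δ hc' hp' hcS hpS hne hk₁ hk₂ hk₃
  · rw [hlive] at hg
    simp only [live, Multiset.mem_add] at hg ⊢
    exact hg.imp (fun h => by simp [hp] at h ⊢; exact Or.inr h) id
  · rcases eq_or_ne v c with rfl | hvc
    · simp [houtc] at hg
    · rcases eq_or_ne v p with rfl | hvp
      · rw [houtp, List.mem_append] at hg
        refine ⟨hpS, ?_⟩
        rcases hg with hg | hg
        · simp [glue, (h.root _ _ hg).2, hne.symm]
        · simp [glue, (h.root _ _ (List.mem_of_mem_filter hg)).2]
      · rw [hout v hvc hvp] at hg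
        obtain ⟨h₁, h₂⟩ := h.root _ _ hg
        exact ⟨h₁, by simp [glue, h₂, hvc]⟩
  · rcases eq_or_ne v c with rfl | hvc
    · simp [houtc]
    · rcases eq_or_ne v p with rfl | hvp
      · rw [houtp, List.map_append, List.nodup_append]
        refine ⟨h.nodup _, ((h.nodup c).sublist ((List.filter_sublist).map _)), ?_⟩
        intro x hx y hy
        obtain ⟨g, hg, rfl⟩ := List.mem_map.1 hx
        obtain ⟨g', hg', rfl⟩ := List.mem_map.1 hy
        have := (List.mem_filter.1 hg').2
        simp only [decide_eq_true_eq] at this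
        exact this g hg
      · rw [hout v hvc hvp]
        exact h.nodup v
  · have : s'.graph S (fun v => glue c p (ρ v)) (fun v => D v + if ρ v = c then δ else 0) =
        graph S { s with pending := rest } (fun v => glue c p (ρ v))
          fun v => D v + if ρ v = c then δ else 0 := by rw [graph, graph, hlive]
    rw [this]
    exact hfold
  · have hrest := sum_le_sum_of_redundant (s := s) (s' := s') (ρ := ρ)
      (ρ' := fun v => glue c p (ρ v)) rest (fun g _ ⟨k, hk, hkl⟩ => by
        by_cases hgc : ρ g.src = c
        · obtain ⟨k', hk', hl⟩ := hred k (hgc ▸ hk)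
          exact ⟨k', by simpa [glue, hgc] using hk', hl.trans hkl⟩
        · refine ⟨k, ?_, hkl⟩
          simp only [glue, hgc, if_false]
          by_cases hgp : ρ g.src = p
          · rw [hgp, houtp]
            exact List.mem_append_left _ (hgp ▸ hk)
          · rwa [hout _ hgc hgp])
    have hBsum : (B.map fun e => if s'.Redundant (fun v => glue c p (ρ v)) e then 1 else 2).sum =
        B.length := by
      rw [List.map_congr_left (g := fun _ => 1)]
      · simp
      · intro g hg
        have hgc := List.mem_of_mem_filter hg
        have : s'.Redundant (fun v => glue c p (ρ v)) g := by
          obtain ⟨k', hk', hl⟩ := hred g hgc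
          exact ⟨k', by simpa [glue, (h.root _ _ hgc).2] using hk', hl⟩
        simp [this]
    have hcard := congrArg Multiset.card hkept
    rw [Multiset.card_add, Multiset.coe_card] at hcard
    have hpend : s'.pending = B ++ rest := rfl
    simp only [work, hp, hpend, List.map_cons, List.sum_cons, if_pos he, List.map_append,
      List.sum_append, hBsum]
    omega
  · have := s.forest.potential_link δ hc' hp' hpS hne hk₁ hk₂ α
    have hforest : s'.forest = s.forest.link c p δ k := rfl
    rw [hforest]
    omega

end Invariant

end FoldState

/-! ### The main loop and the output -/

namespace FoldState

variable {V X : Type*} [DecidableEq V] [DecidableEq X]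
variable {S : Finset V} {ρ : V → V} {D : V → ℤ}

namespace Invariant

variable {Γ : WDigraph V X} {s : FoldState V X} {e f : WEdge V X} {rest : List (WEdge V X)}

theorem foldPair (h : s.Invariant S Γ ρ D) (hp : s.pending = e :: rest)
    (hf : f ∈ s.out (ρ e.src)) (hlab : f.lab = e.lab) (α : ℕ) :
    ∃ (ρ' : V → V) (D' : V → ℤ),
      (FoldState.foldPair { s with pending := rest } (f.current ρ D) (e.current ρ D)).val.Invariant
        S Γ ρ' D' ∧
      (FoldState.foldPair { s with pending := rest } (f.current ρ D) (e.current ρ D)).val.work S ρ' +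
        1 ≤ s.work S ρ ∧
      (FoldState.foldPair { s with pending := rest } (f.current ρ D) (e.current ρ D)).adds +
        (FoldState.foldPair { s with pending := rest } (f.current ρ D)
          (e.current ρ D)).val.forest.potential α S ≤ s.forest.potential α S + (α + 2) := by
  have hsrc := (h.root _ _ hf).2
  have he : s.Redundant ρ e := ⟨f, hf, hlab⟩
  obtain ⟨M, hM, hM'⟩ := h.exists_live_eq hp hf
  have hlive : ∀ g ∈ s.live S, ρ g.tgt ∈ S :=
    fun g hg => h.represents.root_mem _ (h.incident g hg).2
  have heS : ρ e.tgt ∈ S := hlive e (by simp [hM])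
  have hfS : ρ f.tgt ∈ S := hlive f (by simp [hM])
  have hid := h.represents.idem
  unfold FoldState.foldPair
  by_cases htgt : ρ f.tgt = ρ e.tgt
  · have htgt' : (f.current ρ D).tgt = (e.current ρ D).tgt := htgt
    obtain ⟨h₁, h₂⟩ := h.remove hp hf hlab htgt
    rw [if_pos htgt']
    refine ⟨ρ, D, h₁, h₂, ?_⟩
    simp only [Counted.bind, Counted.sub, Counted.gcd, Counted.pure]
    omega
  · have htgt' : ¬ (f.current ρ D).tgt = (e.current ρ D).tgt := htgt
    rw [if_neg htgt']
    split_ifs with hrank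
    · obtain ⟨hstep, -⟩ := foldStep_glue (T := S) (M := M) (N := s.modulus) hlab hsrc htgt
        (D := D) rfl rfl rfl
      rw [Multiset.cons_swap, ← hM, ← hM'] at hstep
      obtain ⟨h₁, h₂, h₃⟩ := h.attach hp he (hid _) (hid _) hfS heS htgt hrank hstep α
      refine ⟨_, _, h₁, h₂, ?_⟩
      simp only [Counted.bind, Counted.sub]
      simp only [WEdge.current] at h₃ ⊢
      omega
    · obtain ⟨hstep, hcur⟩ := foldStep_glue (T := S) (M := M) (N := s.modulus) hlab.symm hsrc.symm
        (Ne.symm htgt) (D := D) rfl rfl rfl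
      -- Here the fold removes the image of `f`, whereas the procedure drops `e`. The two images
      -- coincide after the merger, so the graphs agree.
      rw [Multiset.map_cons _ e M, hcur, ← Multiset.map_cons, ← hM, ← hM'] at hstep
      obtain ⟨h₁, h₂, h₃⟩ := h.attach hp he (hid _) (hid _) heS hfS (Ne.symm htgt)
        (not_le.1 hrank).le hstep α
      refine ⟨_, _, h₁, h₂, ?_⟩
      simp only [Counted.bind, Counted.sub]
      simp only [WEdge.current] at h₃ ⊢
      omega

/-- The constant is two calls of `locate`, 2(2α + 2), plus α + 2 for the fold itself. -/
theorem step (h : s.Invariant S Γ ρ D) (hp : s.pending = e :: rest) {α n : ℕ}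
    (hα : S.card < ack α 0) (hn : S.card ≤ n) :
    ∃ (ρ' : V → V) (D' : V → ℤ),
      (FoldState.step n s).val.Invariant S Γ ρ' D' ∧
      (FoldState.step n s).val.work S ρ' + 1 ≤ s.work S ρ ∧
      (FoldState.step n s).adds + (FoldState.step n s).val.forest.potential α S ≤
        s.forest.potential α S + (5 * α + 6) := by
  obtain ⟨F₁, hv₁, hF₁, hc₁⟩ := locate_represents h.represents hα hn e
  obtain hnone | ⟨f, hsome⟩ := ((s.out (ρ e.src)).find? fun f => f.lab = e.lab).eq_none_or_eq_some
  · have hred : ¬ s.Redundant ρ e := by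
      rintro ⟨g, hg, hl⟩
      simpa [hl] using List.find?_eq_none.1 hnone g hg
    have hstep : FoldState.step n s = ⟨{ s with
        forest := F₁
        out := Function.update s.out (ρ e.src) (e :: s.out (ρ e.src))
        pending := rest }, (locate n s.forest e).adds⟩ := by
      unfold FoldState.step
      rw [hp]
      simp only [Counted.bind, Counted.pure, hv₁, WEdge.current, hnone, add_zero]
    obtain ⟨h₁, h₂⟩ := (h.set_forest hF₁).keep hp hred
    rw [hstep]
    refine ⟨ρ, D, h₁, h₂, ?_⟩
    simp only
    omega
  · obtain ⟨F₂, hv₂, hF₂, hc₂⟩ := locate_represents hF₁ hα hn f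
    have hf := List.mem_of_find?_eq_some hsome
    have hlab : f.lab = e.lab := by simpa using List.find?_some hsome
    have hstep : FoldState.step n s =
        ⟨(FoldState.foldPair { s with forest := F₂, pending := rest } (f.current ρ D)
          (e.current ρ D)).val, (locate n s.forest e).adds + ((locate n F₁ f).adds +
            (FoldState.foldPair { s with forest := F₂, pending := rest } (f.current ρ D)
          (e.current ρ D)).adds)⟩ := by
      unfold FoldState.step
      rw [hp]
      have hsome' : ((s.out (e.current ρ D).src).find? fun f => f.lab = e.lab) = some f := hsome
      simp only [Counted.bind, hv₁, hsome', hv₂]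
    obtain ⟨ρ', D', h₁, h₂, h₃⟩ := (h.set_forest hF₂).foldPair hp hf hlab α
    rw [hstep]
    refine ⟨ρ', D', h₁, h₂, ?_⟩
    simp only at h₃ ⊢
    omega

/-- Potential and remaining work stay on the left so that the output can be charged to them. Steps
idle once nothing is pending, so any bound on `work` is a valid iteration count. -/
theorem run {α n : ℕ} (hα : S.card < ack α 0) (hn : S.card ≤ n) (k : ℕ)
    (h : s.Invariant S Γ ρ D) (hk : s.pending = [] ∨ s.work S ρ ≤ k) :
    ∃ (ρ' : V → V) (D' : V → ℤ),
      (FoldState.run n k s).val.Invariant S Γ ρ' D' ∧ (FoldState.run n k s).val.pending = [] ∧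
      (FoldState.run n k s).adds + (FoldState.run n k s).val.forest.potential α S +
        (FoldState.run n k s).val.work S ρ' * (5 * α + 6) ≤
        s.forest.potential α S + s.work S ρ * (5 * α + 6) := by
  induction k generalizing s ρ D with
  | zero =>
    refine ⟨ρ, D, h, ?_, ?_⟩
    · rcases hk with hk | hk
      · exact hk
      · cases hp : s.pending with
        | nil => exact hp
        | cons e rest =>
          simp only [work, hp, List.map_cons, List.sum_cons] at hk
          split_ifs at hk <;> omega
    · simp [FoldState.run, Counted.pure]
  | succ k ih =>
    cases hp : s.pending with
    | nil =>
      have hs : FoldState.step n s = Counted.pure s := by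
        unfold FoldState.step
        rw [hp]
      simp only [FoldState.run, Counted.bind, hs]
      simpa only [Counted.pure, zero_add] using ih h (Or.inl hp)
    | cons e rest =>
      obtain ⟨ρ₁, D₁, h₁, hw₁, hc₁⟩ := h.step hp hα hn
      have hk' : s.work S ρ ≤ k + 1 := by simpa [hp] using hk
      obtain ⟨ρ₂, D₂, h₂, hp₂, hc₂⟩ := ih h₁ (Or.inr (by omega))
      refine ⟨ρ₂, D₂, h₂, hp₂, ?_⟩
      have := Nat.mul_le_mul_right (5 * α + 6) hw₁
      rw [Nat.succ_mul] at this
      simp only [FoldState.run, Counted.bind]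
      omega

/-- An edge leaving `a` can only be stored in the list of `a`, where labels do not repeat. -/
theorem folded (h : s.Invariant S Γ ρ D) (hp : s.pending = []) : (s.graph S ρ D).Folded := by
  intro a x
  rw [← Multiset.countP_eq_card_filter, graph, Multiset.countP_map,
    ← Multiset.countP_eq_card_filter, live, hp, Multiset.coe_nil, zero_add, kept]
  rw [← Multiset.coe_countPAddMonoidHom, map_sum]
  simp only [Multiset.coe_countPAddMonoidHom]
  have hzero : ∀ v, v ≠ a → Multiset.countP
      (fun e : WEdge V X => (e.current ρ D).src = a ∧ (e.current ρ D).lab = x) (s.out v) = 0 := by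
    intro v hv
    refine Multiset.countP_eq_zero.2 fun e he h' => hv ?_
    rw [← (h.root v e he).2]
    exact h'.1
  have hone : Multiset.countP
      (fun e : WEdge V X => (e.current ρ D).src = a ∧ (e.current ρ D).lab = x) (s.out a) ≤ 1 := by
    refine le_trans ?_ (List.nodup_iff_count_le_one.1 (h.nodup a) x)
    rw [Multiset.coe_countP, List.count, List.countP_map]
    refine List.countP_mono_left fun e _ he => ?_
    simp only [decide_eq_true_eq] at he
    simpa [WEdge.current] using he.2
  by_cases haS : a ∈ S
  · rw [Finset.sum_eq_single_of_mem a haS fun v _ hv => hzero v hv]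
    exact hone
  · rw [Finset.sum_eq_zero fun v hv => hzero v (by rintro rfl; exact haS hv)]
    exact zero_le_one

theorem output {vs : List V} (hvs : vs.Nodup) (h : s.Invariant vs.toFinset Γ ρ D)
    (hp : s.pending = []) {α : ℕ} (hα : vs.toFinset.card < ack α 0) :
    (FoldState.output vs s).val = s.graph vs.toFinset ρ D ∧
      (FoldState.output vs s).adds ≤
        s.forest.potential α vs.toFinset + s.work vs.toFinset ρ * (2 * α + 2) := by
  have hkept : s.kept vs.toFinset = (vs.flatMap s.out : List (WEdge V X)) := by
    rw [kept, List.sum_toFinset _ hvs, ← Multiset.coe_bind, Multiset.bind, Multiset.join,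
      Multiset.map_coe, Multiset.sum_coe]
  obtain ⟨h₁, h₂⟩ := locateAll_represents h.represents hα (List.toFinset_card_of_nodup hvs).le
    (vs.flatMap s.out)
  constructor
  · simp only [FoldState.output, Counted.bind, Counted.pure, graph, h₁, live, hp, hkept,
      Multiset.coe_nil, zero_add, Multiset.map_coe]
    congr 1
    ext v
    simp only [List.toFinset_filter, Finset.mem_filter, List.mem_toFinset, Finset.mem_image,
      decide_eq_true_eq]
    constructor
    · rintro ⟨hv, hr⟩
      exact ⟨v, hv, (h.represents.parent_eq_iff v).1 hr⟩
    · rintro ⟨w, hw, rfl⟩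
      exact ⟨by simpa using h.represents.root_mem w (by simpa using hw), h.represents.parent_root w⟩
  · simp only [FoldState.output, Counted.bind, Counted.pure, work, hp, hkept, Multiset.coe_card]
    simpa using h₂

theorem init {vs : List V} {es : List (WEdge V X)} (hΓ : Γ.Incident)
    (hvs : vs.toFinset = Γ.verts) (hes : (es : Multiset (WEdge V X)) = Γ.edges) :
    (FoldState.init es Γ.modulus).Invariant vs.toFinset Γ id 0 := by
  have hlive : (FoldState.init es Γ.modulus).live vs.toFinset = Γ.edges := by
    simp [live, kept, FoldState.init, hes]
  refine ⟨⟨?_, ?_, ?_, ?_, ?_, ?_, ?_⟩, fun e he => ?_, ?_, ?_, ?_⟩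
  all_goals try simp [FoldState.init]
  · rw [hlive] at he
    rw [← List.mem_toFinset, ← List.mem_toFinset, hvs]
    exact hΓ e he
  · have : (FoldState.init es Γ.modulus).graph vs.toFinset id 0 = Γ := by
      have hcur : WEdge.current (X := X) (id : V → V) 0 = id := by
        funext e
        simp [WEdge.current]
      rw [graph, hlive, hcur, hvs]
      simp [FoldState.init]
    rw [FoldState.init] at this
    rw [this]

end Invariant

theorem work_init_le (vs : List V) (es : List (WEdge V X)) (N : ℕ) :
    (FoldState.init es N).work vs.toFinset id ≤ 2 * es.length := by
  simp [work, kept, Redundant, FoldState.init, mul_comm]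

omit [DecidableEq X] in
theorem potential_init (S : Finset V) (es : List (WEdge V X)) (N α : ℕ) :
    (FoldState.init es N).forest.potential α S = 2 * (α * S.card) := by
  simp [Forest.potential, FoldState.init]
  ring

end FoldState

/-- The folding procedure halts with a result of folding, for every listing of the vertices and
edges of a graph, after a number of additions bounded in terms of the Ackermann function. -/
theorem exists_foldProcedure {V X : Type*} [DecidableEq V] [DecidableEq X] {Γ : WDigraph V X}
    (hΓ : Γ.Incident) {vs : List V} {es : List (WEdge V X)} (hnd : vs.Nodup)
    (hvs : vs.toFinset = Γ.verts) (hes : (es : Multiset (WEdge V X)) = Γ.edges) {α : ℕ}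
    (hα : Γ.verts.card < ack α 0) :
    ∃ (Δ : WDigraph V X) (c : ℕ), FoldProcedure vs es Γ.modulus Δ c ∧ Γ.IsFold Δ ∧
      c ≤ 2 * (α * Γ.verts.card) + 2 * Γ.edges.card * (5 * α + 6) := by
  have hα' : vs.toFinset.card < ack α 0 := by rwa [hvs]
  have hinit := FoldState.Invariant.init hΓ hvs hes
  obtain ⟨k, hk⟩ : ∃ k, (FoldState.init es Γ.modulus).work vs.toFinset id ≤ k := ⟨_, le_rfl⟩
  obtain ⟨ρ, D, hinv, hp, hc⟩ := hinit.run hα' (List.toFinset_card_of_nodup hnd).le k (Or.inr hk)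
  obtain ⟨hval, hadds⟩ := hinv.output hnd hp hα'
  have hw := Nat.mul_le_mul_right (5 * α + 6) (FoldState.work_init_le vs es Γ.modulus)
  rw [← Multiset.coe_card es, hes] at hw
  rw [FoldState.potential_init] at hc
  refine ⟨_, ((FoldState.run vs.length k (FoldState.init es Γ.modulus)).bind
    (FoldState.output vs)).adds, ⟨k, hp, ?_⟩, ⟨hinv.reach, hinv.folded hp⟩, ?_⟩
  · rw [Counted.bind, hval]
  · rw [Counted.bind]
    generalize FoldState.run vs.length k (FoldState.init es Γ.modulus) = t at *
    -- Writing out a remaining edge costs no more than the budget of the unit of work left for it.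
    have := Nat.mul_le_mul_left (t.val.work vs.toFinset ρ) (show 2 * α + 2 ≤ 5 * α + 6 by omega)
    rw [← hvs]
    dsimp only
    omega

/-! ### The size of the completion -/

/-- Free groups are torsion-free, so a non-trivial relator differs from its inverse, and both
contribute. This excludes |Γ| L(R) = 1, where `invAck` vanishes. -/
theorem two_le_totalLength {X : Type*} [DecidableEq X] {R : Finset (FreeGroup X)}
    (hR : IsSymmetrized R) (h : 0 < totalLength R) : 2 ≤ totalLength R := by
  obtain ⟨r, hr, hpos⟩ := Finset.exists_ne_zero_of_sum_ne_zero h.ne'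
  have hne : r ≠ r⁻¹ := by
    intro heq
    have hsq : r ^ 2 = 1 := by rw [pow_two]; exact mul_eq_one_iff_eq_inv.2 heq
    exact hpos (FreeGroup.norm_eq_zero.2 (pow_eq_one_iff_left (by norm_num) |>.1 hsq))
  calc 2 ≤ r.norm + r⁻¹.norm := by rw [FreeGroup.norm_inv_eq]; omega
    _ = ∑ s ∈ {r, r⁻¹}, s.norm := (Finset.sum_pair hne).symm
    _ ≤ totalLength R := Finset.sum_le_sum_of_subset (by
        intro s hs
        rcases Finset.mem_insert.1 hs with rfl | hs
        · exact hr
        · rw [Finset.mem_singleton.1 hs]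
          exact hR.2.1 r hr)

/-- The extra 1 accounts for the trivial word, which may belong to `R`. -/
theorem card_le_totalLength_add_one {X : Type*} [DecidableEq X] (R : Finset (FreeGroup X)) :
    R.card ≤ totalLength R + 1 := by
  calc R.card ≤ (R.erase 1).card + 1 := by
        have := Finset.pred_card_le_card_erase (s := R) (a := 1)
        omega
    _ ≤ ∑ r ∈ R.erase 1, r.norm + 1 := by
        rw [Finset.card_eq_sum_ones]
        gcongr with r hr
        exact Nat.pos_of_ne_zero fun h =>
          (Finset.mem_erase.1 hr).1 (FreeGroup.norm_eq_zero.1 h)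
    _ ≤ totalLength R + 1 := by
        gcongr
        exact Finset.sum_le_sum_of_subset (Finset.erase_subset _ _)

namespace WDigraph

variable {V X : Type*} [DecidableEq V] [DecidableEq X]

theorem card_verts_complete_le (R : Finset (FreeGroup X)) (Γ : WDigraph V X)
    (hR : 0 < totalLength R) :
    (Γ.complete R).verts.card ≤ 4 * (Γ.verts.card * totalLength R) := by
  have hcirc : ∀ v : V, (R.biUnion fun r =>
      (Finset.range (r.norm + 1)).image (circuitVert v r)).card ≤ 2 * totalLength R + 1 := by
    intro v
    have hcard := card_le_totalLength_add_one R
    calc _ ≤ ∑ r ∈ R, ((Finset.range (r.norm + 1)).image (circuitVert v r)).card :=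
          Finset.card_biUnion_le
      _ ≤ ∑ r ∈ R, (r.norm + 1) :=
          Finset.sum_le_sum fun r _ => Finset.card_image_le.trans (Finset.card_range _).le
      _ = totalLength R + R.card := by
          rw [Finset.sum_add_distrib, Finset.card_eq_sum_ones, totalLength]
      _ ≤ 2 * totalLength R + 1 := by omega
  calc (Γ.complete R).verts.card
      ≤ Γ.verts.card + Γ.verts.card * (2 * totalLength R + 1) :=
        (Finset.card_union_le _ _).trans (Nat.add_le_add Finset.card_image_le
          (Finset.card_biUnion_le_card_mul _ _ _ fun v _ => hcirc v))
    _ ≤ 4 * (Γ.verts.card * totalLength R) := by nlinarith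

theorem card_edges_complete (R : Finset (FreeGroup X)) (Γ : WDigraph V X) :
    (Γ.complete R).edges.card = Γ.edges.card + 2 * (Γ.verts.card * totalLength R) := by
  simp only [complete, Multiset.card_add, Multiset.card_map, Multiset.card_sum, Multiset.insert_eq_cons,
    Multiset.card_cons, Multiset.card_singleton, Finset.sum_const, Finset.card_univ,
    Fintype.card_fin, smul_eq_mul, totalLength, FreeGroup.norm, ← Finset.sum_mul]
  ring

theorem Incident.complete {Γ : WDigraph V X} (h : Γ.Incident) (R : Finset (FreeGroup X)) :
    (Γ.complete R).Incident := by
  intro e he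
  simp only [WDigraph.complete, Multiset.mem_add, Multiset.mem_map, Multiset.mem_sum] at he
  have hmem : ∀ v ∈ Γ.verts, ∀ r ∈ R, ∀ i < r.norm + 1,
      circuitVert v r i ∈ (Γ.complete R).verts := by
    intro v hv r hr i hi
    simp only [WDigraph.complete, Finset.mem_union, Finset.mem_biUnion]
    exact Or.inr ⟨v, hv, r, hr, Finset.mem_image_of_mem _ (Finset.mem_range.2 hi)⟩
  rcases he with ⟨f, hf, rfl⟩ | ⟨v, hv, r, hr, i, -, he⟩
  · obtain ⟨h₁, h₂⟩ := h f hf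
    simp only [WDigraph.complete, WEdge.map, Finset.mem_union]
    exact ⟨Or.inl (Finset.mem_image_of_mem _ h₁), Or.inl (Finset.mem_image_of_mem _ h₂)⟩
  · have hi : (i : ℕ) < r.norm := i.2
    have h₁ := hmem v hv r hr i (by omega)
    have h₂ := hmem v hv r hr (i + 1) (by omega)
    simp only [Multiset.insert_eq_cons, Multiset.mem_cons, Multiset.mem_singleton] at he
    rcases he with rfl | rfl
    · exact ⟨h₁, h₂⟩
    · exact ⟨h₂, h₁⟩

end WDigraph

theorem mainTheorem7 :
    ∃ C : ℕ, ∀ (V X : Type*) [DecidableEq V] [DecidableEq X]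
      (R : Finset (FreeGroup X)) (Γ : WDigraph V X),
      IsSymmetrized R → 0 < totalLength R → Γ.Incident →
      ∀ (vs : List (CVert V X)) (es : List (WEdge (CVert V X) X)),
        vs.Nodup → vs.toFinset = (Γ.complete R).verts →
        (es : Multiset (WEdge (CVert V X) X)) = (Γ.complete R).edges →
        ∃ (Δ : WDigraph (CVert V X) X) (c : ℕ),
          FoldProcedure vs es (Γ.complete R).modulus Δ c ∧
          (Γ.complete R).IsFold Δ ∧
          c ≤ C * (Γ.size * totalLength R * invAck (Γ.size * totalLength R)) := by
  refine ⟨192, fun V X _ _ R Γ hR hpos hΓ vs es hnd hvs hes => ?_⟩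
  have hL := two_le_totalLength hR hpos
  set n := Γ.size * totalLength R with hn
  set K := invAck n with hK
  have hverts : (Γ.complete R).verts.card ≤ 4 * n := by
    refine (Γ.card_verts_complete_le R hpos).trans ?_
    exact Nat.mul_le_mul_left 4 (Nat.mul_le_mul_right _ (Nat.le_add_right _ _))
  have hedges : (Γ.complete R).edges.card ≤ 2 * n := by
    rw [Γ.card_edges_complete, hn, WDigraph.size]
    nlinarith
  obtain ⟨Δ, c, hproc, hfold, hc⟩ := exists_foldProcedure (hΓ.complete R) hnd hvs hes
    (hverts.trans_lt (four_mul_lt_ack n))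
  refine ⟨Δ, c, hproc, hfold, hc.trans ?_⟩
  calc 2 * ((K + 5) * (Γ.complete R).verts.card) +
        2 * (Γ.complete R).edges.card * (5 * (K + 5) + 6)
      ≤ 2 * ((K + 5) * (4 * n)) + 2 * (2 * n) * (5 * (K + 5) + 6) := by gcongr
    _ = n * (28 * K + 164) := by ring
    -- 192 = 28 + 164: the additive constant is absorbed because K ≥ 1 unless Γ is empty, when both
    -- sides vanish.
    _ ≤ n * (192 * K) := by
        rcases Nat.eq_zero_or_pos Γ.size with h0 | h0
        · simp [hn, h0]
        · have : 0 < K := invAck_pos (by nlinarith)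
          gcongr
          omega
    _ = 192 * (n * K) := by ring
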